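/- Let $h\in(0,1)$. The state $\omega$ has the normal prior density $\mu_0$ with mean $\omega_0\in\mathbb R$ and variance $\sigma_0^2>0$. Given $\omega$, a signal has density $f(s|\omega)=h f_H(s|\omega)+(1-h)f_L(s|\omega)$, where $f_q(\cdot|\omega)$ is the normal density with mean $\omega$ and variance $\sigma_q^2>0$, $q\in\{H,L\}$. The agent chooses a sampling variance $\sigma_\gamma^2\in(0,\infty]$; with $\gamma$ the normal density with mean $\omega_0$ and variance $\sigma_\gamma^2$ (and $\gamma\equiv 1$, i.e. uniform sampling, if $\sigma_\gamma^2=\infty$), she observes a signal $s$ with density $$g(s|\omega,\sigma_\gamma^2)=\frac{\gamma(s)f(s|\omega)}{\int\gamma(s')f(s'|\omega)\,ds'},$$ then plays an action $a(s,\sigma_\gamma^2)$, and has expected utility $$U_a(\sigma_\gamma^2)=-\int\Big[\int\big(\omega-a(s,\sigma_\gamma^2)\big)^2 g(s|\omega,\sigma_\gamma^2)\,ds\Big]\mu_0(\omega)\,d\omega .$$ Consider the following two action rules $a$: (a) the optimal action, i.e. the posterior expectation $$a^\star(s,\sigma_\gamma^2)=\frac{\int\omega\, g(s|\omega,\sigma_\gamma^2)\mu_0(\omega)\,d\omega}{\int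 g(s|\omega,\sigma_\gamma^2)\mu_0(\omega)\,d\omega};$$ (b) the weighted action $\bar\alpha_\gamma(s)\,\omega_0+(1-\bar\alpha_\gamma(s))\,s$, where $\bar\alpha_\gamma(s)=P(H|s)\alpha_{\gamma H}+(1-P(H|s))\alpha_{\gamma L}$, $\alpha_{\gamma q}=\sigma_0^{-2}/(\sigma_0^{-2}+\sigma_\gamma^{-2}+\sigma_q^{-2})$ (with $\sigma_\gamma^{-2}=0$ if $\sigma_\gamma^2=\infty$) and $P(H|s)=h\int f_H(s|\omega)\mu_0(\omega)\,d\omega\big/\int f(s|\omega)\mu_0(\omega)\,d\omega$. Then for any $h\in(0,1)$, $\sigma_0^2>0$ and $\sigma_H^2>0$ there is a threshold $\kappa^*\in(\sigma_H^2,\infty)$ such that for all $\omega_0\in\mathbb R$ and all $\sigma_L^2>\kappa^*$ the optimal sampling variance is finite: under each of the action rules (a) and (b), $U_a$ attains its maximum over $(0,\infty]$, and every maximizer is finite. -/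

import Mathlib

open MeasureTheory ProbabilityTheory
open scoped NNReal ENNReal

noncomputable section

/-- Parameters of the normal-sampling model: the fraction `h` of high-quality sources, the prior
mean `ω₀`, the prior variance `v₀`, and the variances `vH`, `vL` of the signals of high- and
low-quality sources. -/
structure NormalSampling where
  h : ℝ
  ω₀ : ℝ
  v₀ : ℝ≥0
  vH : ℝ≥0
  vL : ℝ≥0

namespace NormalSampling

variable (M : NormalSampling)

/-- The prior density `μ₀` of the state. -/
def prior (ω : ℝ) : ℝ := gaussianPDFReal M.ω₀ M.v₀ ω

/-- The density `f_H(s|ω)` of a high-quality signal. -/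
def fH (ω s : ℝ) : ℝ := gaussianPDFReal ω M.vH s

/-- The density `f_L(s|ω)` of a low-quality signal. -/
def fL (ω s : ℝ) : ℝ := gaussianPDFReal ω M.vL s

/-- The total signal density `f(s|ω)`. -/
def f (ω s : ℝ) : ℝ := M.h * M.fH ω s + (1 - M.h) * M.fL ω s

/-- The sampling function `γ` with variance `v ∈ (0, ∞]`: the normal density centred at the prior
mean if `v` is finite, and the constant weight `1` (uniform sampling) if `v = ∞`. -/
def γ (v : ℝ≥0∞) (s : ℝ) : ℝ :=
  if v = ∞ then 1 else gaussianPDFReal M.ω₀ v.toNNReal s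

/-- The density `g(s|ω, v)` of the sampled signal, given the state and the sampling variance. -/
def g (v : ℝ≥0∞) (ω s : ℝ) : ℝ :=
  M.γ v s * M.f ω s / ∫ s', M.γ v s' * M.f ω s'

/-- The optimal action after the signal `s`, that is, the posterior expectation of the state. -/
def bayesAction (v : ℝ≥0∞) (s : ℝ) : ℝ :=
  (∫ ω, ω * (M.g v ω s * M.prior ω)) / ∫ ω, M.g v ω s * M.prior ω

/-- The probability `P(H|s)` that a signal `s` comes from a high-quality source. -/
def probH (s : ℝ) : ℝ :=
  (∫ ω, M.h * M.fH ω s * M.prior ω) / ∫ ω, M.f ω s * M.prior ω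

/-- The weight on the prior mean for a source of variance `vq`, where `1 / ∞ = 0`. -/
def α (v : ℝ≥0∞) (vq : ℝ≥0) : ℝ :=
  (M.v₀ : ℝ)⁻¹ / ((M.v₀ : ℝ)⁻¹ + (v⁻¹).toReal + (vq : ℝ)⁻¹)

/-- The averaged weight on the prior mean after the signal `s`. -/
def αbar (v : ℝ≥0∞) (s : ℝ) : ℝ :=
  M.probH s * M.α v M.vH + (1 - M.probH s) * M.α v M.vL

/-- The closed-form action: the average of the prior mean and the signal with weights `αbar` and
`1 - αbar`. -/
def weightedAction (v : ℝ≥0∞) (s : ℝ) : ℝ :=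
  M.αbar v s * M.ω₀ + (1 - M.αbar v s) * s

/-- Expected quadratic loss of the action rule `a` under the sampling variance `v`; an integral of
a nonnegative function, with values in `[0, ∞]`. -/
def expectedLoss (v : ℝ≥0∞) (a : ℝ → ℝ) : ℝ≥0∞ :=
  ∫⁻ ω, (∫⁻ s, ENNReal.ofReal ((ω - a s) ^ 2 * M.g v ω s)) * ENNReal.ofReal (M.prior ω)

/-- Expected utility, for the utility function `-(a - ω)²`. -/
def expectedUtility (v : ℝ≥0∞) (a : ℝ → ℝ) : EReal := -(M.expectedLoss v a : EReal)

/-- `v` is an optimal sampling variance, among all variances in `(0, ∞]`, for an agent who plays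
the action rule `a w` when the sampling variance is `w`. -/
def IsOptimalVariance (a : ℝ≥0∞ → ℝ → ℝ) (v : ℝ≥0∞) : Prop :=
  0 < v ∧ ∀ w : ℝ≥0∞, 0 < w → M.expectedUtility w (a w) ≤ M.expectedUtility v (a v)

end NormalSampling

end

open Filter Topology Set

noncomputable section

/-! ### Gaussian densities -/

/-! With `x = v / (1 + v)`, `δ = ω - ω₀`, `s = ω₀ + √x * r`, the model extends continuously to `x =
0`, and by Fatou the loss is lower semicontinuous on `[0, 1]` along any action rule continuous in
`x`. So a minimum over `[0, 1]` exists (`exists_loss_le`), and it suffices to find one interior `x`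
whose loss is below the losses at `x = 0` and `x = 1` (`exists_isOptimalVariance`).

At `x = 0` the signal is independent of the state, so the loss is at least `v₀` (`le_loss_zero`). At
`x = 1` it is at least the average posterior variance `B = h * v₀vH/(v₀+vH) + (1-h) * v₀vL/(v₀+vL)`
of an agent who is told the quality (`le_loss_one`), and `B ≤ v₀`.

For fixed `x < 1`, concentrated sampling discards low-quality signals: their mass under the sampling
weight tends to `0` as `vL → ∞` (`tendsto_mass_atTop`), whereas at `x = 1` it is always `1`. Hence
the loss of the weighted action tends to that of a model with high-quality sources only
(`tendsto_loss_centredWeighted`). This limit is continuous in `x` and equals `v₀vH/(v₀+vH)` at `x =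
1`, strictly below `lim B = h * v₀vH/(v₀+vH) + (1-h) * v₀`. So `x` is fixed close to `1` first, and
then `vL` is taken large. The Bayes action loses no more than the weighted one, so the same `x`
serves both rules. -/

theorem gaussianPDFReal_le_inv_sqrt (m : ℝ) (v : ℝ≥0) (x : ℝ) :
    gaussianPDFReal m v x ≤ (√(2 * Real.pi * v))⁻¹ := by
  rw [gaussianPDFReal]
  refine mul_le_of_le_one_right (by positivity) (Real.exp_le_one_iff.2 ?_)
  exact div_nonpos_of_nonpos_of_nonneg (neg_nonpos.2 (sq_nonneg _)) (by positivity)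

theorem continuous_gaussianPDFReal_comp {X : Type*} [TopologicalSpace X] (v : ℝ≥0) {m x : X → ℝ}
    (hm : Continuous m) (hx : Continuous x) :
    Continuous fun z => gaussianPDFReal (m z) v (x z) := by
  unfold gaussianPDFReal
  fun_prop

theorem measurable_gaussianPDFReal_comp {X : Type*} [MeasurableSpace X] (v : ℝ≥0) {m x : X → ℝ}
    (hm : Measurable m) (hx : Measurable x) :
    Measurable fun z => gaussianPDFReal (m z) v (x z) := by
  unfold gaussianPDFReal
  fun_prop

theorem integrable_gaussianReal_iff (m : ℝ) {v : ℝ≥0} (hv : v ≠ 0) (u : ℝ → ℝ) :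
    Integrable u (gaussianReal m v) ↔ Integrable fun x => u x * gaussianPDFReal m v x := by
  rw [gaussianReal_of_var_ne_zero m hv,
    integrable_withDensity_iff (measurable_gaussianPDF m v) (ae_of_all _ fun x => gaussianPDF_lt_top)]
  simp

theorem integrable_mul_gaussianPDFReal (m : ℝ) {v : ℝ≥0} (hv : v ≠ 0) :
    Integrable fun x => x * gaussianPDFReal m v x :=
  (integrable_gaussianReal_iff m hv _).1
    ((memLp_id_gaussianReal (μ := m) (v := v) 1).integrable (by simp))

theorem integrable_sq_mul_gaussianPDFReal (m : ℝ) {v : ℝ≥0} (hv : v ≠ 0) :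
    Integrable fun x => x ^ 2 * gaussianPDFReal m v x :=
  (integrable_gaussianReal_iff m hv _).1
    ((memLp_id_gaussianReal (μ := m) (v := v) 2).integrable_sq)

theorem integral_sq_gaussianReal (m : ℝ) (v : ℝ≥0) :
    ∫ x, x ^ 2 ∂gaussianReal m v = v + m ^ 2 := by
  have h := variance_eq_sub (memLp_id_gaussianReal (μ := m) (v := v) 2)
  rw [variance_id_gaussianReal] at h
  simp only [Pi.pow_apply, id, integral_id_gaussianReal] at h
  linarith

/-- The second moment of an affine function under a Gaussian density. -/
theorem lintegral_sq_mul_gaussianPDFReal (a b c m : ℝ) (hc : 0 ≤ c) {v : ℝ≥0} (hv : v ≠ 0) :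
    ∫⁻ x, ENNReal.ofReal (((a - b * x) ^ 2 + c) * gaussianPDFReal m v x) =
      ENNReal.ofReal ((a - b * m) ^ 2 + b ^ 2 * v + c) := by
  have e : ∀ x : ℝ, (a - b * x) ^ 2 + c = (a ^ 2 + c) - 2 * a * b * x + b ^ 2 * x ^ 2 := by
    intro x; ring
  have i1 : Integrable (fun x : ℝ => x) (gaussianReal m v) :=
    (memLp_id_gaussianReal (μ := m) (v := v) 1).integrable (by simp)
  have i2 : Integrable (fun x : ℝ => x ^ 2) (gaussianReal m v) :=
    (memLp_id_gaussianReal (μ := m) (v := v) 2).integrable_sq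
  have i3 : Integrable (fun x : ℝ => (a - b * x) ^ 2 + c) (gaussianReal m v) := by
    simp only [e]
    exact ((integrable_const _).sub (i1.const_mul _)).add (i2.const_mul _)
  have h : ∫ x, ((a - b * x) ^ 2 + c) ∂gaussianReal m v = (a - b * m) ^ 2 + b ^ 2 * v + c := by
    have i4 : Integrable (fun x : ℝ => (a ^ 2 + c) - 2 * a * b * x) (gaussianReal m v) :=
      (integrable_const _).sub (i1.const_mul _)
    simp only [e]
    rw [integral_add i4 (i2.const_mul _),
      integral_sub (integrable_const _) (i1.const_mul _), integral_const_mul, integral_const_mul,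
      integral_id_gaussianReal, integral_sq_gaussianReal]
    simp
    ring
  rw [← h, integral_gaussianReal_eq_integral_smul hv, ofReal_integral_eq_lintegral_ofReal]
  · simp only [smul_eq_mul, mul_comm]
  · simpa only [smul_eq_mul, mul_comm] using (integrable_gaussianReal_iff m hv _).1 i3
  · exact ae_of_all _ fun x => mul_nonneg (gaussianPDFReal_nonneg _ _ _) (by positivity)

/-- Bayes' rule for a Gaussian prior and a Gaussian signal. -/
theorem gaussianPDFReal_mul_prior {p q : ℝ≥0} (hp : p ≠ 0) (hq : q ≠ 0) (δ s : ℝ) :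
    gaussianPDFReal δ q s * gaussianPDFReal 0 p δ =
      gaussianPDFReal 0 (p + q) s * gaussianPDFReal (p * s / (p + q)) (p * q / (p + q)) δ := by
  have hp' : (0 : ℝ) < p := by positivity
  have hq' : (0 : ℝ) < q := by positivity
  simp only [gaussianPDFReal]
  rw [mul_mul_mul_comm, mul_mul_mul_comm (√(2 * Real.pi * ↑(p + q)))⁻¹, ← Real.exp_add,
    ← Real.exp_add, ← mul_inv, ← mul_inv, ← Real.sqrt_mul (by positivity),
    ← Real.sqrt_mul (by positivity)]
  push_cast
  congr 2
  · congr 1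
    field_simp
  · field_simp
    ring

/-- The marginal density of a Gaussian signal with a Gaussian prior. -/
theorem integral_gaussianPDFReal_mul_prior {p q : ℝ≥0} (hp : p ≠ 0) (hq : q ≠ 0) (s : ℝ) :
    ∫ δ, gaussianPDFReal δ q s * gaussianPDFReal 0 p δ = gaussianPDFReal 0 (p + q) s := by
  simp only [gaussianPDFReal_mul_prior hp hq]
  rw [integral_const_mul, integral_gaussianPDFReal_eq_one, mul_one]
  positivity

/-! ### Lebesgue integrals -/

theorem lintegral_comp_add_mul (u : ℝ → ℝ≥0∞) (b : ℝ) {c : ℝ} (hc : 0 < c) :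
    ∫⁻ s, u s = ENNReal.ofReal c * ∫⁻ r, u (b + c * r) := by
  rw [← lintegral_add_left_eq_self u b]
  conv_lhs => rw [← Real.smul_map_volume_mul_left hc.ne']
  rw [lintegral_smul_measure, abs_of_pos hc,
    (measurableEmbedding_mulLeft₀ hc.ne').lintegral_map, smul_eq_mul]

theorem integral_comp_add_mul (u : ℝ → ℝ) (b : ℝ) {c : ℝ} (hc : 0 < c) :
    ∫ s, u s = c * ∫ r, u (b + c * r) := by
  rw [Measure.integral_comp_mul_left (fun y => u (b + y)) c, integral_add_left_eq_self u b,
    abs_of_pos (inv_pos.2 hc), smul_eq_mul, mul_inv_cancel_left₀ hc.ne']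

/-- By Fatou's lemma, an integral that depends continuously on a parameter in a compact set
attains its minimum. -/
theorem IsCompact.exists_lintegral_le {X : Type*} [MeasurableSpace X] {μ : Measure X} {S : Set ℝ}
    (hS : IsCompact S) (hne : S.Nonempty) (F : ℝ → X → ℝ≥0∞) (hF : ∀ x, Measurable (F x))
    (hc : ∀ z, ContinuousOn (fun x => F x z) S) :
    ∃ x ∈ S, ∀ y ∈ S, ∫⁻ z, F x z ∂μ ≤ ∫⁻ z, F y z ∂μ := by
  have hl : LowerSemicontinuousOn (fun x => ∫⁻ z, F x z ∂μ) S := by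
    rw [lowerSemicontinuousOn_iff_le_liminf]
    intro x hx
    calc ∫⁻ z, F x z ∂μ = ∫⁻ z, liminf (fun y => F y z) (𝓝[S] x) ∂μ := by
          refine lintegral_congr fun z => ?_
          have : (𝓝[S] x).NeBot := mem_closure_iff_nhdsWithin_neBot.1 (subset_closure hx)
          exact (hc z x hx).liminf_eq.symm
      _ ≤ _ := lintegral_liminf_le hF
  obtain ⟨x, hx, h⟩ := hl.exists_isMinOn hne hS
  exact ⟨x, hx, fun y hy => h hy⟩

/-- Among all constants, the mean has the least quadratic loss. -/
theorem lintegral_sub_mean_sq_le {k : ℝ → ℝ} (k0 : ∀ δ, 0 ≤ k δ) (i0 : Integrable k)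
    (i1 : Integrable fun δ => δ * k δ) (i2 : Integrable fun δ => δ ^ 2 * k δ)
    (hk : 0 < ∫ δ, k δ) (b : ℝ) :
    ∫⁻ δ, ENNReal.ofReal ((δ - (∫ δ, δ * k δ) / ∫ δ, k δ) ^ 2 * k δ) ≤
      ∫⁻ δ, ENNReal.ofReal ((δ - b) ^ 2 * k δ) := by
  have key : ∀ c : ℝ, ∫⁻ δ, ENNReal.ofReal ((δ - c) ^ 2 * k δ) =
      ENNReal.ofReal ((∫ δ, δ ^ 2 * k δ) - 2 * c * (∫ δ, δ * k δ) + c ^ 2 * ∫ δ, k δ) := by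
    intro c
    have e : ∀ δ : ℝ, (δ - c) ^ 2 * k δ = δ ^ 2 * k δ - 2 * c * (δ * k δ) + c ^ 2 * k δ := by
      intro δ; ring
    have hi : Integrable fun δ => (δ - c) ^ 2 * k δ := by
      simp only [e]
      exact (i2.sub (i1.const_mul _)).add (i0.const_mul _)
    rw [← ofReal_integral_eq_lintegral_ofReal hi
      (ae_of_all _ fun δ => mul_nonneg (sq_nonneg _) (k0 δ))]
    have i4 : Integrable fun δ => δ ^ 2 * k δ - 2 * c * (δ * k δ) := i2.sub (i1.const_mul _)
    simp only [e]
    rw [integral_add i4 (i0.const_mul _), integral_sub i2 (i1.const_mul _),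
      integral_const_mul, integral_const_mul]
  rw [key, key]
  refine ENNReal.ofReal_le_ofReal ?_
  set A := ∫ δ, δ * k δ
  set B := ∫ δ, k δ
  have h1 : 2 * (A / B) * A = 2 * (A ^ 2 / B) := by ring
  have h2 : (A / B) ^ 2 * B = A ^ 2 / B := by field_simp
  have h3 : 0 ≤ (A - b * B) ^ 2 / B := by positivity
  have h4 : (A - b * B) ^ 2 / B = A ^ 2 / B - 2 * b * A + b ^ 2 * B := by field_simp; ring
  rw [h1, h2]
  linarith

namespace NormalSampling

/-! ### Compactified coordinates

A sampling variance `v ∈ (0, ∞]` is encoded by `x = v / (1 + v) ∈ (0, 1]`, the state by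
`δ = ω - ω₀` and the signal by `r` with `s = ω₀ + √x * r`. In these coordinates the model extends
continuously to `x = 0`. -/

/-- The ratio between the variance of a source and that of its rescaled sampled signal. -/
def varRatio (q : ℝ≥0) (x : ℝ) : ℝ := (1 - x) * q + x

/-- The unnormalized density of the rescaled sampled signal of a source of variance `q`. -/
def kern (q : ℝ≥0) (x δ r : ℝ) : ℝ :=
  Real.exp (-((1 - x) * r ^ 2 / 2)) * gaussianPDFReal δ q (√x * r)

/-- The total mass of `kern q x δ`. -/
def mass (q : ℝ≥0) (x δ : ℝ) : ℝ :=
  (√(varRatio q x))⁻¹ * Real.exp (-((1 - x) * δ ^ 2 / (2 * varRatio q x)))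

variable {q : ℝ≥0} {x : ℝ}

theorem varRatio_pos (hq : 0 < q) (hx : x ∈ Icc (0 : ℝ) 1) : 0 < varRatio q x := by
  have hq' : (0 : ℝ) < q := hq
  rcases hx.1.eq_or_lt with rfl | h
  · simpa [varRatio] using hq
  · have := mul_nonneg (sub_nonneg.2 hx.2) hq'.le
    rw [varRatio]
    linarith

theorem continuous_varRatio (q : ℝ≥0) : Continuous (varRatio q) := by
  unfold varRatio
  fun_prop

theorem mass_pos (hq : 0 < q) (hx : x ∈ Icc (0 : ℝ) 1) (δ : ℝ) : 0 < mass q x δ := by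
  have := varRatio_pos hq hx
  rw [mass]
  positivity

theorem kern_nonneg (q : ℝ≥0) (x δ r : ℝ) : 0 ≤ kern q x δ r :=
  mul_nonneg (Real.exp_pos _).le (gaussianPDFReal_nonneg _ _ _)

theorem kern_pos (hq : 0 < q) (x δ r : ℝ) : 0 < kern q x δ r :=
  mul_pos (Real.exp_pos _) (gaussianPDFReal_pos _ _ _ hq.ne')

/-- The rescaled sampled signal of a single source is Gaussian. -/
theorem kern_eq_mass_mul (hq : 0 < q) (hx : x ∈ Icc (0 : ℝ) 1) (δ r : ℝ) :
    kern q x δ r = mass q x δ *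
      gaussianPDFReal (√x * δ / varRatio q x) (q / varRatio q x).toNNReal r := by
  have hq' : (0 : ℝ) < q := hq
  have hD := varRatio_pos hq hx
  have hs : √x ^ 2 = x := Real.sq_sqrt hx.1
  have hV : (((q / varRatio q x).toNNReal : ℝ≥0) : ℝ) = q / varRatio q x :=
    Real.coe_toNNReal _ (by positivity)
  simp only [kern, mass, gaussianPDFReal, hV]
  rw [mul_left_comm, mul_mul_mul_comm, ← Real.exp_add, ← Real.exp_add, ← mul_inv,
    ← Real.sqrt_mul hD.le]
  congr 2
  · congr 1
    field_simp
  · field_simp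
    have : varRatio q x = (1 - x) * q + x := rfl
    -- With `x = t ^ 2` and `D` expanded, completing the square in `r` is a polynomial identity.
    generalize varRatio q x = D at *
    generalize √x = t at *
    subst hs
    subst this
    ring

theorem continuousOn_mass (hq : 0 < q) (δ : ℝ) :
    ContinuousOn (fun x => mass q x δ) (Icc 0 1) := by
  have hc := (continuous_varRatio q).continuousOn (s := Icc (0 : ℝ) 1)
  unfold mass
  refine ContinuousOn.mul (ContinuousOn.inv₀ hc.sqrt fun x hx => ?_) ?_
  · exact (Real.sqrt_pos.2 (varRatio_pos hq hx)).ne'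
  · refine (ContinuousOn.div (by fun_prop) (by fun_prop) fun x hx => ?_).neg.rexp
    have := varRatio_pos hq hx
    positivity

theorem continuous_kern (q : ℝ≥0) (δ r : ℝ) : Continuous fun x => kern q x δ r := by
  unfold kern gaussianPDFReal
  fun_prop

theorem measurable_kern (q : ℝ≥0) (x : ℝ) : Measurable fun z : ℝ × ℝ => kern q x z.1 z.2 := by
  unfold kern gaussianPDFReal
  fun_prop

theorem measurable_mass (q : ℝ≥0) (x : ℝ) : Measurable (mass q x) := by
  unfold mass
  fun_prop

theorem integrable_kern (hq : 0 < q) (hx : x ∈ Icc (0 : ℝ) 1) (δ : ℝ) :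
    Integrable (kern q x δ) := by
  rw [funext (kern_eq_mass_mul hq hx δ)]
  exact (integrable_gaussianPDFReal _ _).const_mul _

theorem integral_kern (hq : 0 < q) (hx : x ∈ Icc (0 : ℝ) 1) (δ : ℝ) :
    ∫ r, kern q x δ r = mass q x δ := by
  simp only [kern_eq_mass_mul hq hx δ]
  have hq' : (0 : ℝ) < q := hq
  rw [integral_const_mul, integral_gaussianPDFReal_eq_one, mul_one]
  simpa using div_pos hq' (varRatio_pos hq hx)

/-- The peak of a Gaussian of variance `q / D` is `√(D / (2πq))`, and `D ≤ q + 1`. Keeping the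
factor `mass` lets it cancel against the normalization. -/
theorem kern_le (hq : 0 < q) (hx : x ∈ Icc (0 : ℝ) 1) (δ r : ℝ) :
    kern q x δ r ≤ mass q x δ * √(1 + (q : ℝ)⁻¹) := by
  have hq' : (0 : ℝ) < q := hq
  have hD := varRatio_pos hq hx
  rw [kern_eq_mass_mul hq hx]
  refine mul_le_mul_of_nonneg_left ((gaussianPDFReal_le_inv_sqrt _ _ _).trans ?_)
    (mass_pos hq hx δ).le
  rw [← Real.sqrt_inv, Real.coe_toNNReal _ (by positivity)]
  refine Real.sqrt_le_sqrt ?_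
  have h1 : varRatio q x ≤ q + 1 := by
    have := mul_nonneg hx.1 hq'.le
    rw [varRatio]; linarith [hx.2]
  calc (2 * Real.pi * (q / varRatio q x))⁻¹ = (2 * Real.pi)⁻¹ * (varRatio q x / q) := by
        field_simp
    _ ≤ 1 * ((q + 1) / q) := by
        refine mul_le_mul (inv_le_one_of_one_le₀ ?_) (by gcongr) (by positivity) zero_le_one
        linarith [Real.pi_gt_three]
    _ = 1 + (q : ℝ)⁻¹ := by field_simp

/-! ### The model in compactified coordinates -/

variable (M : NormalSampling)

/-- The assumptions on the parameters of the model. -/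
structure IsRegular : Prop where
  h_pos : 0 < M.h
  h_lt_one : M.h < 1
  v₀_pos : 0 < M.v₀
  vH_pos : 0 < M.vH
  vL_pos : 0 < M.vL

/-- The density of the rescaled sampled signal `r` given the centred state `δ`. -/
def signalDensity (x δ r : ℝ) : ℝ :=
  (M.h * kern M.vH x δ r + (1 - M.h) * kern M.vL x δ r) /
    (M.h * mass M.vH x δ + (1 - M.h) * mass M.vL x δ)

/-- The joint density of the centred state and the rescaled sampled signal. -/
def jointDensity (x δ r : ℝ) : ℝ := M.signalDensity x δ r * gaussianPDFReal 0 M.v₀ δ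

/-- The expected loss of the action rule `b` in the compactified coordinates. -/
def loss (x : ℝ) (b : ℝ → ℝ) : ℝ≥0∞ :=
  ∫⁻ z : ℝ × ℝ, ENNReal.ofReal ((z.1 - b z.2) ^ 2 * M.jointDensity x z.1 z.2)

/-- The centred Bayes action. -/
def centredBayes (x r : ℝ) : ℝ :=
  (∫ δ, δ * M.jointDensity x δ r) / ∫ δ, M.jointDensity x δ r

/-- The weight on the prior mean for a source of variance `q`. -/
def priorWeight (q : ℝ≥0) (x : ℝ) : ℝ :=
  (M.v₀ : ℝ)⁻¹ * x / ((M.v₀ : ℝ)⁻¹ * x + (1 - x) + (q : ℝ)⁻¹ * x)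

/-- The probability that a centred signal `s` comes from a high-quality source. -/
def centredProbH (s : ℝ) : ℝ :=
  M.h * gaussianPDFReal 0 (M.v₀ + M.vH) s /
    (M.h * gaussianPDFReal 0 (M.v₀ + M.vH) s + (1 - M.h) * gaussianPDFReal 0 (M.v₀ + M.vL) s)

/-- The centred weighted action. -/
def centredWeighted (x r : ℝ) : ℝ :=
  (1 - (M.centredProbH (√x * r) * M.priorWeight M.vH x +
    (1 - M.centredProbH (√x * r)) * M.priorWeight M.vL x)) * (√x * r)

variable {M}

theorem IsRegular.mass_pos (hM : M.IsRegular) (hx : x ∈ Icc (0 : ℝ) 1) (δ : ℝ) :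
    0 < M.h * mass M.vH x δ + (1 - M.h) * mass M.vL x δ :=
  add_pos (mul_pos hM.h_pos (NormalSampling.mass_pos hM.vH_pos hx δ))
    (mul_pos (sub_pos.2 hM.h_lt_one) (NormalSampling.mass_pos hM.vL_pos hx δ))

theorem IsRegular.signalDensity_pos (hM : M.IsRegular) (hx : x ∈ Icc (0 : ℝ) 1) (δ r : ℝ) :
    0 < M.signalDensity x δ r :=
  div_pos (add_pos (mul_pos hM.h_pos (kern_pos hM.vH_pos _ _ _))
    (mul_pos (sub_pos.2 hM.h_lt_one) (kern_pos hM.vL_pos _ _ _))) (hM.mass_pos hx δ)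

/-- Each kernel is bounded by a multiple of its own mass, so the quotient is bounded independently
of `x`, `δ` and `r`. Thus a multiple of the prior dominates the joint density. -/
theorem IsRegular.signalDensity_le (hM : M.IsRegular) (hx : x ∈ Icc (0 : ℝ) 1) (δ r : ℝ) :
    M.signalDensity x δ r ≤ √(1 + (M.vH : ℝ)⁻¹) + √(1 + (M.vL : ℝ)⁻¹) := by
  rw [signalDensity, div_le_iff₀ (hM.mass_pos hx δ)]
  have h1 := mul_le_mul_of_nonneg_left (kern_le hM.vH_pos hx δ r) hM.h_pos.le
  have h2 := mul_le_mul_of_nonneg_left (kern_le hM.vL_pos hx δ r) (sub_pos.2 hM.h_lt_one).le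
  have h3 : 0 ≤ M.h * mass M.vH x δ * √(1 + (M.vL : ℝ)⁻¹) :=
    mul_nonneg (mul_nonneg hM.h_pos.le (NormalSampling.mass_pos hM.vH_pos hx δ).le)
      (Real.sqrt_nonneg _)
  have h4 : 0 ≤ (1 - M.h) * mass M.vL x δ * √(1 + (M.vH : ℝ)⁻¹) :=
    mul_nonneg (mul_nonneg (sub_pos.2 hM.h_lt_one).le
      (NormalSampling.mass_pos hM.vL_pos hx δ).le) (Real.sqrt_nonneg _)
  linarith

theorem measurable_signalDensity (M : NormalSampling) (x : ℝ) :
    Measurable fun z : ℝ × ℝ => M.signalDensity x z.1 z.2 := by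
  have h1 := measurable_kern M.vH x
  have h2 := measurable_kern M.vL x
  have h3 : Measurable fun z : ℝ × ℝ => mass M.vH x z.1 :=
    (measurable_mass M.vH x).comp measurable_fst
  have h4 : Measurable fun z : ℝ × ℝ => mass M.vL x z.1 :=
    (measurable_mass M.vL x).comp measurable_fst
  exact ((h1.const_mul _).add (h2.const_mul _)).div ((h3.const_mul _).add (h4.const_mul _))

theorem measurable_jointDensity (M : NormalSampling) (x : ℝ) :
    Measurable fun z : ℝ × ℝ => M.jointDensity x z.1 z.2 :=
  (measurable_signalDensity M x).mul
    (measurable_gaussianPDFReal_comp _ measurable_const measurable_fst)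

theorem IsRegular.continuousOn_signalDensity (hM : M.IsRegular) (δ r : ℝ) :
    ContinuousOn (fun x => M.signalDensity x δ r) (Icc 0 1) := by
  have h1 := (continuous_kern M.vH δ r).continuousOn (s := Icc (0 : ℝ) 1)
  have h2 := (continuous_kern M.vL δ r).continuousOn (s := Icc (0 : ℝ) 1)
  have h3 := continuousOn_mass hM.vH_pos δ
  have h4 := continuousOn_mass hM.vL_pos δ
  exact ((h1.const_mul _).add (h2.const_mul _)).div ((h3.const_mul _).add (h4.const_mul _))
    fun x hx => (hM.mass_pos hx δ).ne'

theorem IsRegular.continuousOn_jointDensity (hM : M.IsRegular) (δ r : ℝ) :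
    ContinuousOn (fun x => M.jointDensity x δ r) (Icc 0 1) :=
  (hM.continuousOn_signalDensity δ r).mul continuousOn_const

theorem IsRegular.jointDensity_pos (hM : M.IsRegular) (hx : x ∈ Icc (0 : ℝ) 1) (δ r : ℝ) :
    0 < M.jointDensity x δ r :=
  mul_pos (hM.signalDensity_pos hx δ r) (gaussianPDFReal_pos _ _ _ hM.v₀_pos.ne')

theorem IsRegular.jointDensity_le (hM : M.IsRegular) (hx : x ∈ Icc (0 : ℝ) 1) (δ r : ℝ) :
    M.jointDensity x δ r ≤
      (√(1 + (M.vH : ℝ)⁻¹) + √(1 + (M.vL : ℝ)⁻¹)) * gaussianPDFReal 0 M.v₀ δ :=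
  mul_le_mul_of_nonneg_right (hM.signalDensity_le hx δ r) (gaussianPDFReal_nonneg _ _ _)

/-- Integrability of a function against the joint density follows from that against the prior. -/
theorem IsRegular.integrable_mul_jointDensity (hM : M.IsRegular) (hx : x ∈ Icc (0 : ℝ) 1) (r : ℝ)
    {u : ℝ → ℝ} (hu : Measurable u) (hi : Integrable fun δ => u δ * gaussianPDFReal 0 M.v₀ δ) :
    Integrable fun δ => u δ * M.jointDensity x δ r := by
  refine (hi.norm.const_mul (√(1 + (M.vH : ℝ)⁻¹) + √(1 + (M.vL : ℝ)⁻¹))).mono'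
    (hu.mul ((measurable_jointDensity M x).comp (measurable_id.prodMk measurable_const))
      ).aestronglyMeasurable (ae_of_all _ fun δ => ?_)
  rw [norm_mul, norm_mul, Real.norm_of_nonneg (hM.jointDensity_pos hx δ r).le,
    Real.norm_of_nonneg (gaussianPDFReal_nonneg _ _ _), mul_left_comm]
  exact mul_le_mul_of_nonneg_left (hM.jointDensity_le hx δ r) (norm_nonneg _)

theorem IsRegular.integrable_jointDensity (hM : M.IsRegular) (hx : x ∈ Icc (0 : ℝ) 1) (r : ℝ) :
    Integrable fun δ => M.jointDensity x δ r := by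
  simpa using hM.integrable_mul_jointDensity hx r measurable_one
    (by simpa using integrable_gaussianPDFReal 0 M.v₀)

theorem IsRegular.integrable_id_mul_jointDensity (hM : M.IsRegular) (hx : x ∈ Icc (0 : ℝ) 1)
    (r : ℝ) : Integrable fun δ => δ * M.jointDensity x δ r :=
  hM.integrable_mul_jointDensity hx r measurable_id
    (integrable_mul_gaussianPDFReal 0 hM.v₀_pos.ne')

theorem IsRegular.integral_jointDensity_pos (hM : M.IsRegular) (hx : x ∈ Icc (0 : ℝ) 1) (r : ℝ) :
    0 < ∫ δ, M.jointDensity x δ r := by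
  refine (integral_pos_iff_support_of_nonneg (fun δ => (hM.jointDensity_pos hx δ r).le)
    (hM.integrable_jointDensity hx r)).2 ?_
  have : (Function.support fun δ => M.jointDensity x δ r) = univ :=
    Set.eq_univ_of_forall fun δ => (hM.jointDensity_pos hx δ r).ne'
  simp [this]

/-! ### The loss and the Bayes action -/

/-- The expected loss as an average over the signals. -/
theorem loss_eq_lintegral_lintegral (M : NormalSampling) (x : ℝ) {b : ℝ → ℝ} (hb : Measurable b) :
    M.loss x b = ∫⁻ r, ∫⁻ δ, ENNReal.ofReal ((δ - b r) ^ 2 * M.jointDensity x δ r) := by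
  rw [loss, Measure.volume_eq_prod, lintegral_prod_symm']
  exact (((measurable_fst.sub (hb.comp measurable_snd)).pow_const 2).mul
    (measurable_jointDensity M x)).ennreal_ofReal

/-- The Bayes action minimizes the expected loss. -/
theorem IsRegular.loss_centredBayes_le (hM : M.IsRegular) (hx : x ∈ Icc (0 : ℝ) 1) {b : ℝ → ℝ}
    (hb : Measurable b) (hB : Measurable (M.centredBayes x)) :
    M.loss x (M.centredBayes x) ≤ M.loss x b := by
  rw [M.loss_eq_lintegral_lintegral x hb, M.loss_eq_lintegral_lintegral x hB]
  refine lintegral_mono fun r => ?_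
  exact lintegral_sub_mean_sq_le (fun δ => (hM.jointDensity_pos hx δ r).le)
    (hM.integrable_jointDensity hx r) (hM.integrable_id_mul_jointDensity hx r)
    (hM.integrable_mul_jointDensity hx r (measurable_id.pow_const 2)
      (integrable_sq_mul_gaussianPDFReal 0 hM.v₀_pos.ne'))
    (hM.integral_jointDensity_pos hx r) (b r)

theorem measurable_centredBayes (M : NormalSampling) (x : ℝ) : Measurable (M.centredBayes x) := by
  have h : StronglyMeasurable fun z : ℝ × ℝ => M.jointDensity x z.1 z.2 :=
    (measurable_jointDensity M x).stronglyMeasurable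
  have h' : StronglyMeasurable fun z : ℝ × ℝ => z.1 * M.jointDensity x z.1 z.2 :=
    (measurable_fst.mul (measurable_jointDensity M x)).stronglyMeasurable
  exact h'.integral_prod_left'.measurable.div h.integral_prod_left'.measurable

/-- Dominated convergence in numerator and denominator: the domination by the prior is uniform in
`x`, and the prior has a first moment. -/
theorem IsRegular.continuousOn_centredBayes (hM : M.IsRegular) (r : ℝ) :
    ContinuousOn (fun x => M.centredBayes x r) (Icc 0 1) := by
  have key : ∀ u : ℝ → ℝ, Measurable u → (Integrable fun δ => u δ * gaussianPDFReal 0 M.v₀ δ) →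
      ContinuousOn (fun x => ∫ δ, u δ * M.jointDensity x δ r) (Icc 0 1) := by
    intro u hu hi
    refine continuousOn_of_dominated
      (bound := fun δ => (√(1 + (M.vH : ℝ)⁻¹) + √(1 + (M.vL : ℝ)⁻¹)) *
        ‖u δ * gaussianPDFReal 0 M.v₀ δ‖) (fun x hx => ?_) (fun x hx => ?_) (hi.norm.const_mul _)
        (ae_of_all _ fun δ => continuousOn_const.mul (hM.continuousOn_jointDensity δ r))
    · exact (hM.integrable_mul_jointDensity hx r hu hi).aestronglyMeasurable
    · refine ae_of_all _ fun δ => ?_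
      rw [norm_mul, norm_mul, Real.norm_of_nonneg (hM.jointDensity_pos hx δ r).le,
        Real.norm_of_nonneg (gaussianPDFReal_nonneg _ _ _), mul_left_comm]
      exact mul_le_mul_of_nonneg_left (hM.jointDensity_le hx δ r) (norm_nonneg _)
  refine (key id measurable_id (integrable_mul_gaussianPDFReal 0 hM.v₀_pos.ne')).div ?_
    fun x hx => (hM.integral_jointDensity_pos hx r).ne'
  simpa using key 1 measurable_one (by simpa using integrable_gaussianPDFReal 0 M.v₀)

/-! ### The weighted action -/

theorem IsRegular.priorWeight_denom_pos (hM : M.IsRegular) (q : ℝ≥0) (hx : x ∈ Icc (0 : ℝ) 1) :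
    0 < (M.v₀ : ℝ)⁻¹ * x + (1 - x) + (q : ℝ)⁻¹ * x := by
  have hv : (0 : ℝ) < M.v₀ := hM.v₀_pos
  have h1 : 0 ≤ (q : ℝ)⁻¹ * x := mul_nonneg (by positivity) hx.1
  rcases hx.1.eq_or_lt with rfl | h
  · simp
  · have : 0 < (M.v₀ : ℝ)⁻¹ * x := by positivity
    linarith [hx.2]

theorem IsRegular.priorWeight_mem (hM : M.IsRegular) (q : ℝ≥0) (hx : x ∈ Icc (0 : ℝ) 1) :
    M.priorWeight q x ∈ Icc (0 : ℝ) 1 := by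
  have h := hM.priorWeight_denom_pos q hx
  have h1 : 0 ≤ (q : ℝ)⁻¹ * x := mul_nonneg (by positivity) hx.1
  have h2 : 0 ≤ (M.v₀ : ℝ)⁻¹ * x := mul_nonneg (by positivity) hx.1
  refine ⟨div_nonneg h2 h.le, (div_le_one h).2 ?_⟩
  linarith [hx.2]

theorem IsRegular.continuousOn_priorWeight (hM : M.IsRegular) (q : ℝ≥0) :
    ContinuousOn (M.priorWeight q) (Icc 0 1) := by
  unfold priorWeight
  exact ContinuousOn.div (by fun_prop) (by fun_prop)
    fun x hx => (hM.priorWeight_denom_pos q hx).ne'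

theorem IsRegular.signal_marginal_pos (hM : M.IsRegular) (s : ℝ) :
    0 < M.h * gaussianPDFReal 0 (M.v₀ + M.vH) s +
      (1 - M.h) * gaussianPDFReal 0 (M.v₀ + M.vL) s :=
  add_pos (mul_pos hM.h_pos (gaussianPDFReal_pos _ _ _ (add_pos hM.v₀_pos hM.vH_pos).ne'))
    (mul_pos (sub_pos.2 hM.h_lt_one)
      (gaussianPDFReal_pos _ _ _ (add_pos hM.v₀_pos hM.vL_pos).ne'))

theorem IsRegular.centredProbH_mem (hM : M.IsRegular) (s : ℝ) :
    M.centredProbH s ∈ Icc (0 : ℝ) 1 := by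
  have h1 : 0 ≤ M.h * gaussianPDFReal 0 (M.v₀ + M.vH) s :=
    mul_nonneg hM.h_pos.le (gaussianPDFReal_nonneg _ _ _)
  have h2 : 0 ≤ (1 - M.h) * gaussianPDFReal 0 (M.v₀ + M.vL) s :=
    mul_nonneg (sub_pos.2 hM.h_lt_one).le (gaussianPDFReal_nonneg _ _ _)
  refine ⟨div_nonneg h1 (add_nonneg h1 h2), (div_le_one (hM.signal_marginal_pos s)).2 ?_⟩
  linarith

theorem IsRegular.continuous_centredProbH (hM : M.IsRegular) : Continuous M.centredProbH := by
  have hc : ∀ v : ℝ≥0, Continuous (gaussianPDFReal 0 v) := fun v =>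
    continuous_gaussianPDFReal_comp v continuous_const continuous_id
  exact ((hc _).const_mul _).div (((hc _).const_mul _).add ((hc _).const_mul _))
    fun s => (hM.signal_marginal_pos s).ne'

theorem IsRegular.continuousOn_centredWeighted (hM : M.IsRegular) (r : ℝ) :
    ContinuousOn (fun x => M.centredWeighted x r) (Icc 0 1) := by
  have h1 : ContinuousOn (fun x => M.centredProbH (√x * r)) (Icc 0 1) :=
    (hM.continuous_centredProbH.comp (by fun_prop)).continuousOn
  have h2 := hM.continuousOn_priorWeight M.vH
  have h3 := hM.continuousOn_priorWeight M.vL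
  unfold centredWeighted
  fun_prop

theorem measurable_centredWeighted (hM : M.IsRegular) (x : ℝ) :
    Measurable (M.centredWeighted x) := by
  have h1 := hM.continuous_centredProbH
  refine Continuous.measurable ?_
  unfold centredWeighted
  fun_prop

/-- The weight on the signal is in `[0, 1]` and `√x ≤ 1`. The bound does not involve `vL`, so it can
dominate as `vL → ∞`. -/
theorem IsRegular.abs_centredWeighted_le (hM : M.IsRegular) (hx : x ∈ Icc (0 : ℝ) 1) (r : ℝ) :
    |M.centredWeighted x r| ≤ |r| := by
  obtain ⟨p0, p1⟩ := hM.centredProbH_mem (√x * r)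
  obtain ⟨a0, a1⟩ := hM.priorWeight_mem M.vH hx
  obtain ⟨b0, b1⟩ := hM.priorWeight_mem M.vL hx
  rw [centredWeighted, abs_mul, abs_mul, abs_of_nonneg (Real.sqrt_nonneg x), ← mul_assoc]
  refine mul_le_of_le_one_left (abs_nonneg _) (mul_le_one₀ ?_ (Real.sqrt_nonneg x)
    (Real.sqrt_le_one.2 hx.2))
  rw [abs_le]
  constructor <;> nlinarith [mul_nonneg p0 a0, mul_nonneg (sub_nonneg.2 p1) b0,
    mul_nonneg p0 (sub_nonneg.2 a1), mul_nonneg (sub_nonneg.2 p1) (sub_nonneg.2 b1)]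

/-- A continuous family of action rules has an optimal parameter. -/
theorem IsRegular.exists_loss_le (hM : M.IsRegular) (b : ℝ → ℝ → ℝ) (hb : ∀ x, Measurable (b x))
    (hc : ∀ r, ContinuousOn (fun x => b x r) (Icc 0 1)) :
    ∃ x ∈ Icc (0 : ℝ) 1, ∀ y ∈ Icc (0 : ℝ) 1, M.loss x (b x) ≤ M.loss y (b y) := by
  refine isCompact_Icc.exists_lintegral_le (nonempty_Icc.2 zero_le_one)
    (fun x (z : ℝ × ℝ) => ENNReal.ofReal ((z.1 - b x z.2) ^ 2 * M.jointDensity x z.1 z.2))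
    (fun x => ?_) (fun z => ?_)
  · exact (((measurable_fst.sub ((hb x).comp measurable_snd)).pow_const 2).mul
      (measurable_jointDensity M x)).ennreal_ofReal
  · exact ENNReal.continuous_ofReal.comp_continuousOn
      (((continuousOn_const.sub (hc z.2)).pow 2).mul (hM.continuousOn_jointDensity z.1 z.2))

end NormalSampling

namespace NormalSampling

variable {M : NormalSampling} {x : ℝ}

/-! ### Lower bounds for the loss -/

/-- The mean squared distance from `c` is the variance plus a squared bias, which is dropped; the
bound holds whatever the action. -/
theorem ofReal_mul_le_lintegral_sq (c A m : ℝ) (hA : 0 ≤ A) {τ : ℝ≥0} (hτ : τ ≠ 0) :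
    ENNReal.ofReal A * τ ≤
      ∫⁻ δ, ENNReal.ofReal ((δ - c) ^ 2 * (A * gaussianPDFReal m τ δ)) := by
  have e : ∀ δ, ENNReal.ofReal ((δ - c) ^ 2 * (A * gaussianPDFReal m τ δ)) =
      ENNReal.ofReal A * ENNReal.ofReal (((c - 1 * δ) ^ 2 + 0) * gaussianPDFReal m τ δ) := by
    intro δ
    rw [← ENNReal.ofReal_mul hA]
    congr 1
    ring
  simp only [e]
  rw [lintegral_const_mul' _ _ ENNReal.ofReal_ne_top,
    lintegral_sq_mul_gaussianPDFReal c 1 0 m le_rfl hτ]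
  gcongr
  rw [← ENNReal.ofReal_coe_nnreal]
  refine ENNReal.ofReal_le_ofReal ?_
  linarith [sq_nonneg (c - 1 * m)]

/-- At `x = 0`, `varRatio q 0 = q`, so the rescaled signal of every source is standard normal,
whatever the state. -/
theorem jointDensity_zero (hM : M.IsRegular) (δ r : ℝ) :
    M.jointDensity 0 δ r = gaussianPDFReal 0 1 r * gaussianPDFReal 0 M.v₀ δ := by
  have h0 : (0 : ℝ) ∈ Icc (0 : ℝ) 1 := by simp
  have e : ∀ {q : ℝ≥0}, 0 < q → kern q 0 δ r = mass q 0 δ * gaussianPDFReal 0 1 r := by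
    intro q hq
    have hq' : (q : ℝ) ≠ 0 := by positivity
    rw [kern_eq_mass_mul hq h0]
    simp [varRatio, hq']
  rw [jointDensity, signalDensity, e hM.vH_pos, e hM.vL_pos, ← mul_assoc, ← mul_assoc, ← add_mul,
    mul_div_right_comm, div_self (hM.mass_pos h0 δ).ne', one_mul]

/-- Without any informative signal, the loss is at least the prior variance. -/
theorem IsRegular.le_loss_zero (hM : M.IsRegular) {b : ℝ → ℝ} (hb : Measurable b) :
    (M.v₀ : ℝ≥0∞) ≤ M.loss 0 b := by
  rw [M.loss_eq_lintegral_lintegral 0 hb]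
  calc (M.v₀ : ℝ≥0∞) = ∫⁻ r, ENNReal.ofReal (gaussianPDFReal 0 1 r) * M.v₀ := by
        rw [lintegral_mul_const' _ _ ENNReal.coe_ne_top,
          lintegral_gaussianPDFReal_eq_one 0 one_ne_zero, one_mul]
    _ ≤ _ := by
        refine lintegral_mono fun r => ?_
        simp only [jointDensity_zero hM]
        exact ofReal_mul_le_lintegral_sq _ _ _ (gaussianPDFReal_nonneg _ _ _) hM.v₀_pos.ne'

/-- At `x = 1` all masses are `1`, so no normalization couples the two sources, and Bayes' rule
splits each term into signal marginal and posterior. -/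
theorem jointDensity_one (hM : M.IsRegular) (δ r : ℝ) :
    M.jointDensity 1 δ r =
      M.h * (gaussianPDFReal 0 (M.v₀ + M.vH) r *
        gaussianPDFReal (M.v₀ * r / (M.v₀ + M.vH)) (M.v₀ * M.vH / (M.v₀ + M.vH)) δ) +
      (1 - M.h) * (gaussianPDFReal 0 (M.v₀ + M.vL) r *
        gaussianPDFReal (M.v₀ * r / (M.v₀ + M.vL)) (M.v₀ * M.vL / (M.v₀ + M.vL)) δ) := by
  rw [← gaussianPDFReal_mul_prior hM.v₀_pos.ne' hM.vH_pos.ne',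
    ← gaussianPDFReal_mul_prior hM.v₀_pos.ne' hM.vL_pos.ne']
  simp [jointDensity, signalDensity, mass, kern, varRatio]
  ring

/-- Under uniform sampling, the loss is at least that of an agent who learns the quality of the
source. -/
theorem IsRegular.le_loss_one (hM : M.IsRegular) {b : ℝ → ℝ} (hb : Measurable b) :
    ENNReal.ofReal (M.h * (M.v₀ * M.vH / (M.v₀ + M.vH)) +
      (1 - M.h) * (M.v₀ * M.vL / (M.v₀ + M.vL))) ≤ M.loss 1 b := by
  have hh := hM.h_pos
  have hh' := sub_pos.2 hM.h_lt_one
  have h0 := hM.v₀_pos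
  have hH := hM.vH_pos
  have hL := hM.vL_pos
  have hint : ∀ q : ℝ≥0, 0 < q → ∀ c : ℝ, 0 ≤ c →
      ∫⁻ r, ENNReal.ofReal (c * gaussianPDFReal 0 (M.v₀ + q) r) *
        (M.v₀ * q / (M.v₀ + q) : ℝ≥0) = ENNReal.ofReal (c * (M.v₀ * q / (M.v₀ + q))) := by
    intro q hq c hc
    simp only [ENNReal.ofReal_mul hc]
    rw [lintegral_mul_const' _ _ ENNReal.coe_ne_top,
      lintegral_const_mul' _ _ ENNReal.ofReal_ne_top,
      lintegral_gaussianPDFReal_eq_one 0 (by positivity), mul_one]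
    congr 1
    rw [← ENNReal.ofReal_coe_nnreal]
    simp
  rw [M.loss_eq_lintegral_lintegral 1 hb, ENNReal.ofReal_add (by positivity) (by positivity),
    ← hint _ hH _ hh.le, ← hint _ hL _ hh'.le, ← lintegral_add_left]
  · refine lintegral_mono fun r => ?_
    have hm : ∀ c m (τ : ℝ≥0), Measurable fun δ =>
        ENNReal.ofReal ((δ - b r) ^ 2 * (c * gaussianPDFReal m τ δ)) := fun c m τ =>
      (((measurable_id.sub_const (b r)).pow_const 2).mul
        ((measurable_gaussianPDFReal m τ).const_mul c)).ennreal_ofReal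
    have e : ∀ δ, ENNReal.ofReal ((δ - b r) ^ 2 * M.jointDensity 1 δ r) =
        ENNReal.ofReal ((δ - b r) ^ 2 * (M.h * gaussianPDFReal 0 (M.v₀ + M.vH) r *
          gaussianPDFReal (M.v₀ * r / (M.v₀ + M.vH)) (M.v₀ * M.vH / (M.v₀ + M.vH)) δ)) +
        ENNReal.ofReal ((δ - b r) ^ 2 * ((1 - M.h) * gaussianPDFReal 0 (M.v₀ + M.vL) r *
          gaussianPDFReal (M.v₀ * r / (M.v₀ + M.vL)) (M.v₀ * M.vL / (M.v₀ + M.vL)) δ)) := by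
      intro δ
      rw [jointDensity_one hM, ← mul_assoc, ← mul_assoc, mul_add, ENNReal.ofReal_add]
      · exact mul_nonneg (sq_nonneg _) (mul_nonneg (mul_nonneg hh.le (gaussianPDFReal_nonneg _ _ _))
          (gaussianPDFReal_nonneg _ _ _))
      · exact mul_nonneg (sq_nonneg _) (mul_nonneg (mul_nonneg hh'.le
          (gaussianPDFReal_nonneg _ _ _)) (gaussianPDFReal_nonneg _ _ _))
    simp only [e]
    rw [lintegral_add_left (hm _ _ _)]
    exact add_le_add
      (ofReal_mul_le_lintegral_sq _ _ _ (mul_nonneg hh.le (gaussianPDFReal_nonneg _ _ _))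
        (by positivity))
      (ofReal_mul_le_lintegral_sq _ _ _ (mul_nonneg hh'.le (gaussianPDFReal_nonneg _ _ _))
        (by positivity))
  · exact ((measurable_gaussianPDFReal _ _).const_mul _).ennreal_ofReal.mul_const _

/-! ### Change of coordinates -/

/-- The coordinate in `(0, 1]` of a sampling variance in `(0, ∞]`. -/
def coord (v : ℝ≥0∞) : ℝ := (1 + (v⁻¹).toReal)⁻¹

/-- No hypothesis on `v` is needed: `((0 : ℝ≥0∞)⁻¹).toReal = 0` gives `coord 0 = 1`. Results that
identify `v` with its coordinate therefore assume `0 < v`. -/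
theorem coord_pos (v : ℝ≥0∞) : 0 < coord v := by
  unfold coord
  positivity

theorem coord_mem (v : ℝ≥0∞) : coord v ∈ Icc (0 : ℝ) 1 :=
  ⟨(coord_pos v).le, inv_le_one_of_one_le₀ (by simp)⟩

theorem coord_top : coord ∞ = 1 := by simp [coord]

theorem toReal_inv_mul_coord (v : ℝ≥0∞) : (v⁻¹).toReal * coord v = 1 - coord v := by
  have : 0 < 1 + (v⁻¹).toReal := by positivity
  unfold coord
  field_simp
  ring

theorem exists_coord_eq (hx : x ∈ Ioc (0 : ℝ) 1) : ∃ v : ℝ≥0∞, 0 < v ∧ coord v = x := by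
  have h : 0 ≤ x⁻¹ - 1 := sub_nonneg.2 ((one_le_inv₀ hx.1).2 hx.2)
  refine ⟨(ENNReal.ofReal (x⁻¹ - 1))⁻¹, by simp, ?_⟩
  rw [coord, inv_inv, ENNReal.toReal_ofReal h]
  simp

theorem gaussianPDFReal_add_add (c m s : ℝ) (v : ℝ≥0) :
    gaussianPDFReal (c + m) v (c + s) = gaussianPDFReal m v s := by
  simp [gaussianPDFReal]

/-- The exponent is `x * r ^ 2 / (2 * v)` with `x / v = 1 - x`. The constant is left unspecified
since it cancels in `g`. -/
theorem exists_γ_eq (M : NormalSampling) {v : ℝ≥0∞} (hv : 0 < v) : ∃ C : ℝ, 0 < C ∧ ∀ r,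
    M.γ v (M.ω₀ + √(coord v) * r) = C * Real.exp (-((1 - coord v) * r ^ 2 / 2)) := by
  by_cases ht : v = ∞
  · subst ht
    exact ⟨1, one_pos, fun r => by simp [γ, coord_top]⟩
  · lift v to ℝ≥0 using ht
    have hv' : 0 < v := by simpa using hv
    refine ⟨(√(2 * Real.pi * v))⁻¹, by positivity, fun r => ?_⟩
    rw [← toReal_inv_mul_coord]
    simp only [γ, ENNReal.coe_ne_top, if_false, ENNReal.toNNReal_coe, gaussianPDFReal,
      add_sub_cancel_left, mul_pow, Real.sq_sqrt (coord_pos v).le]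
    congr 2
    rw [← ENNReal.coe_inv hv'.ne', ENNReal.coe_toReal]
    push_cast
    field_simp

theorem f_shift (M : NormalSampling) (δ s : ℝ) : M.f (M.ω₀ + δ) (M.ω₀ + s) =
    M.h * gaussianPDFReal δ M.vH s + (1 - M.h) * gaussianPDFReal δ M.vL s := by
  simp only [f, fH, fL, gaussianPDFReal_add_add]

/-- The factor `√(coord v)` is the Jacobian of `s = ω₀ + √x * r`. -/
theorem IsRegular.sqrt_mul_g (hM : M.IsRegular) {v : ℝ≥0∞} (hv : 0 < v) (δ r : ℝ) :
    √(coord v) * M.g v (M.ω₀ + δ) (M.ω₀ + √(coord v) * r) = M.signalDensity (coord v) δ r := by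
  obtain ⟨C, hC, hγ⟩ := M.exists_γ_eq hv
  have hs : 0 < √(coord v) := Real.sqrt_pos.2 (coord_pos v)
  have e : ∀ r, M.γ v (M.ω₀ + √(coord v) * r) * M.f (M.ω₀ + δ) (M.ω₀ + √(coord v) * r) =
      C * (M.h * kern M.vH (coord v) δ r + (1 - M.h) * kern M.vL (coord v) δ r) := by
    intro r
    rw [hγ, f_shift, kern, kern]
    ring
  have hI : ∫ s, M.γ v s * M.f (M.ω₀ + δ) s = √(coord v) *
      (C * (M.h * mass M.vH (coord v) δ + (1 - M.h) * mass M.vL (coord v) δ)) := by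
    rw [integral_comp_add_mul _ M.ω₀ hs]
    simp only [e]
    rw [integral_const_mul, integral_add
      ((integrable_kern hM.vH_pos (coord_mem v) δ).const_mul _)
      ((integrable_kern hM.vL_pos (coord_mem v) δ).const_mul _), integral_const_mul,
      integral_const_mul, integral_kern hM.vH_pos (coord_mem v),
      integral_kern hM.vL_pos (coord_mem v)]
  have hm := hM.mass_pos (coord_mem v) δ
  rw [g, e, hI, signalDensity]
  field_simp

theorem prior_shift (M : NormalSampling) (δ : ℝ) :
    M.prior (M.ω₀ + δ) = gaussianPDFReal 0 M.v₀ δ := by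
  simp [prior, gaussianPDFReal]

theorem IsRegular.expectedLoss_eq (hM : M.IsRegular) {v : ℝ≥0∞} (hv : 0 < v) {a : ℝ → ℝ}
    {b : ℝ → ℝ} (hb : Measurable b) (hab : ∀ r, a (M.ω₀ + √(coord v) * r) = M.ω₀ + b r) :
    M.expectedLoss v a = M.loss (coord v) b := by
  have hs : 0 < √(coord v) := Real.sqrt_pos.2 (coord_pos v)
  rw [expectedLoss, ← lintegral_add_left_eq_self _ M.ω₀, loss, Measure.volume_eq_prod,
    lintegral_prod]
  · refine lintegral_congr fun δ => ?_
    rw [lintegral_comp_add_mul _ M.ω₀ hs, ← lintegral_const_mul' _ _ ENNReal.ofReal_ne_top,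
      ← lintegral_mul_const' _ _ ENNReal.ofReal_ne_top]
    refine lintegral_congr fun r => ?_
    rw [prior_shift, ← ENNReal.ofReal_mul hs.le,
      ← ENNReal.ofReal_mul' (gaussianPDFReal_nonneg _ _ _), mul_left_comm, hM.sqrt_mul_g hv, hab,
      add_sub_add_left_eq_sub, jointDensity, mul_assoc]
  · exact (((measurable_fst.sub (hb.comp measurable_snd)).pow_const 2).mul
      (measurable_jointDensity M _)).ennreal_ofReal.aemeasurable

theorem IsRegular.bayesAction_eq (hM : M.IsRegular) {v : ℝ≥0∞} (hv : 0 < v) (r : ℝ) :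
    M.bayesAction v (M.ω₀ + √(coord v) * r) = M.ω₀ + M.centredBayes (coord v) r := by
  have hs : 0 < √(coord v) := Real.sqrt_pos.2 (coord_pos v)
  have e : ∀ δ, M.g v (M.ω₀ + δ) (M.ω₀ + √(coord v) * r) * M.prior (M.ω₀ + δ) =
      (√(coord v))⁻¹ * M.jointDensity (coord v) δ r := by
    intro δ
    rw [jointDensity, ← hM.sqrt_mul_g hv, prior_shift]
    field_simp
  have hp := hM.integral_jointDensity_pos (coord_mem v) r
  rw [bayesAction, ← integral_add_left_eq_self _ M.ω₀,
    ← integral_add_left_eq_self (fun ω => M.g v ω _ * M.prior ω) M.ω₀]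
  simp only [e, mul_left_comm _ (√(coord v))⁻¹]
  rw [integral_const_mul, integral_const_mul, mul_div_mul_left _ _ (inv_pos.2 hs).ne']
  simp only [add_mul]
  rw [integral_add ((hM.integrable_jointDensity (coord_mem v) r).const_mul _)
    (hM.integrable_id_mul_jointDensity (coord_mem v) r), integral_const_mul, add_div,
    mul_div_cancel_right₀ _ hp.ne', centredBayes]

theorem IsRegular.probH_shift (hM : M.IsRegular) (s : ℝ) :
    M.probH (M.ω₀ + s) = M.centredProbH s := by
  have hi : ∀ {q : ℝ≥0}, 0 < q → Integrable fun δ =>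
      gaussianPDFReal δ q s * gaussianPDFReal 0 M.v₀ δ := by
    intro q hq
    simp only [gaussianPDFReal_mul_prior hM.v₀_pos.ne' hq.ne']
    exact (integrable_gaussianPDFReal _ _).const_mul _
  rw [probH, ← integral_add_left_eq_self _ M.ω₀,
    ← integral_add_left_eq_self (fun ω => M.f ω _ * M.prior ω) M.ω₀]
  simp only [f_shift, prior_shift, fH, gaussianPDFReal_add_add, add_mul, mul_assoc]
  rw [integral_add ((hi hM.vH_pos).const_mul _) ((hi hM.vL_pos).const_mul _), integral_const_mul,
    integral_const_mul, integral_gaussianPDFReal_mul_prior hM.v₀_pos.ne' hM.vH_pos.ne',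
    integral_gaussianPDFReal_mul_prior hM.v₀_pos.ne' hM.vL_pos.ne', centredProbH]

theorem α_eq (M : NormalSampling) (v : ℝ≥0∞) (q : ℝ≥0) :
    M.α v q = M.priorWeight q (coord v) := by
  rw [α, priorWeight, ← toReal_inv_mul_coord, ← add_mul, ← add_mul,
    mul_div_mul_right _ _ (coord_pos v).ne']

theorem IsRegular.weightedAction_eq (hM : M.IsRegular) (v : ℝ≥0∞) (r : ℝ) :
    M.weightedAction v (M.ω₀ + √(coord v) * r) = M.ω₀ + M.centredWeighted (coord v) r := by
  rw [weightedAction, αbar, hM.probH_shift, α_eq, α_eq, centredWeighted]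
  ring

/-- If the loss of a continuous family of action rules is smaller at an interior point than at the
boundary, then the optimal sampling variances exist and are finite. -/
theorem IsRegular.exists_isOptimalVariance (hM : M.IsRegular) (a : ℝ≥0∞ → ℝ → ℝ)
    (b : ℝ → ℝ → ℝ) (hb : ∀ x, Measurable (b x))
    (hc : ∀ r, ContinuousOn (fun x => b x r) (Icc 0 1))
    (hab : ∀ v, 0 < v → ∀ r, a v (M.ω₀ + √(coord v) * r) = M.ω₀ + b (coord v) r)
    (hx : x ∈ Ioo (0 : ℝ) 1) (h0 : M.loss x (b x) < M.loss 0 (b 0))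
    (h1 : M.loss x (b x) < M.loss 1 (b 1)) :
    (∃ v, M.IsOptimalVariance a v) ∧ ∀ v, M.IsOptimalVariance a v → v < ∞ := by
  have hloss : ∀ v, 0 < v → M.expectedLoss v (a v) = M.loss (coord v) (b (coord v)) :=
    fun v hv => hM.expectedLoss_eq hv (hb _) (hab v hv)
  have hle : ∀ v w, 0 < v → 0 < w → (M.expectedUtility w (a w) ≤ M.expectedUtility v (a v) ↔
      M.loss (coord v) (b (coord v)) ≤ M.loss (coord w) (b (coord w))) := by
    intro v w hv hw
    rw [expectedUtility, expectedUtility, EReal.neg_le_neg_iff, EReal.coe_ennreal_le_coe_ennreal_iff,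
      hloss v hv, hloss w hw]
  constructor
  · obtain ⟨y, hy, hmin⟩ := hM.exists_loss_le b hb hc
    -- The point `y = 0` corresponds to no admissible variance, so it must be excluded.
    have hy0 : y ≠ 0 := by
      rintro rfl
      exact (h0.trans_le (hmin x (Ioo_subset_Icc_self hx))).false
    obtain ⟨v, hv, rfl⟩ := exists_coord_eq ⟨lt_of_le_of_ne hy.1 hy0.symm, hy.2⟩
    exact ⟨v, hv, fun w hw => (hle v w hv hw).2 (hmin _ (coord_mem w))⟩
  · rintro v ⟨hv, hopt⟩
    rw [lt_top_iff_ne_top]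
    rintro rfl
    obtain ⟨w, hw, rfl⟩ := exists_coord_eq (Ioo_subset_Ioc_self hx)
    have := (hle _ _ hv hw).1 (hopt w hw)
    rw [coord_top] at this
    exact (h1.trans_le this).false

end NormalSampling

namespace NormalSampling

variable {M : NormalSampling} {x : ℝ}

/-! ### Low-quality sources of large variance -/

/-- The model in which the variance of the low-quality sources is replaced by `q`. -/
def withLow (M : NormalSampling) (q : ℝ≥0) : NormalSampling := { M with vL := q }

theorem IsRegular.withLow (hM : M.IsRegular) {q : ℝ≥0} (hq : 0 < q) : (M.withLow q).IsRegular :=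
  ⟨hM.h_pos, hM.h_lt_one, hM.v₀_pos, hM.vH_pos, hq⟩

theorem tendsto_coe_atTop : Tendsto (fun q : ℝ≥0 => (q : ℝ)) atTop atTop :=
  NNReal.tendsto_coe_atTop.2 tendsto_id

theorem tendsto_inv_sqrt_mul_atTop {c : ℝ} (hc : 0 < c) (d : ℝ) :
    Tendsto (fun q : ℝ≥0 => (√(c * q + d))⁻¹) atTop (𝓝 0) :=
  (Real.tendsto_sqrt_atTop.comp (tendsto_atTop_add_const_right _ d
    (tendsto_coe_atTop.const_mul_atTop hc))).inv_tendsto_atTop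

/-- The offset `p` covers both uses: `p = 0` for kernels and `p = v₀` for signal marginals. -/
theorem tendsto_gaussianPDFReal_atTop (m s : ℝ) (p : ℝ≥0) :
    Tendsto (fun q : ℝ≥0 => gaussianPDFReal m (p + q) s) atTop (𝓝 0) := by
  refine squeeze_zero (fun q => gaussianPDFReal_nonneg _ _ _)
    (fun q => gaussianPDFReal_le_inv_sqrt _ _ _) ?_
  refine (tendsto_inv_sqrt_mul_atTop Real.two_pi_pos (2 * Real.pi * p)).congr fun q => ?_
  push_cast
  congr 2
  ring

theorem tendsto_kern_atTop (x δ r : ℝ) :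
    Tendsto (fun q : ℝ≥0 => kern q x δ r) atTop (𝓝 0) := by
  unfold kern
  simpa using (tendsto_gaussianPDFReal_atTop δ (√x * r) 0).const_mul
    (Real.exp (-((1 - x) * r ^ 2 / 2)))

/-- Here `x < 1` is essential: `varRatio q x = (1 - x) * q + x` grows with `q`, while at `x = 1` the
mass is `1` for all `q`. -/
theorem tendsto_mass_atTop (hx : x ∈ Ioo (0 : ℝ) 1) (δ : ℝ) :
    Tendsto (fun q : ℝ≥0 => mass q x δ) atTop (𝓝 0) := by
  have hx' := sub_pos.2 hx.2
  refine squeeze_zero' ?_ ?_ (tendsto_inv_sqrt_mul_atTop hx' x)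
  · filter_upwards [eventually_gt_atTop 0] with q hq
    exact (mass_pos hq (Ioo_subset_Icc_self hx) δ).le
  · filter_upwards [eventually_gt_atTop 0] with q hq
    have := varRatio_pos hq (Ioo_subset_Icc_self hx)
    refine mul_le_of_le_one_right (by positivity) (Real.exp_le_one_iff.2 ?_)
    rw [neg_nonpos]
    positivity

theorem IsRegular.tendsto_jointDensity (hM : M.IsRegular) (hx : x ∈ Ioo (0 : ℝ) 1) (δ r : ℝ) :
    Tendsto (fun q => (M.withLow q).jointDensity x δ r) atTop
      (𝓝 (gaussianPDFReal (√x * δ / varRatio M.vH x) (M.vH / varRatio M.vH x).toNNReal r *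
        gaussianPDFReal 0 M.v₀ δ)) := by
  have hm := NormalSampling.mass_pos hM.vH_pos (Ioo_subset_Icc_self hx) δ
  have hh := hM.h_pos
  refine Tendsto.mul_const _ ?_
  have h := (((tendsto_kern_atTop x δ r).const_mul (1 - M.h)).const_add
    (M.h * kern M.vH x δ r)).div (((tendsto_mass_atTop hx δ).const_mul (1 - M.h)).const_add
    (M.h * mass M.vH x δ)) (by simpa using ⟨hh.ne', hm.ne'⟩)
  have e : (M.h * kern M.vH x δ r + (1 - M.h) * 0) / (M.h * mass M.vH x δ + (1 - M.h) * 0) =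
      gaussianPDFReal (√x * δ / varRatio M.vH x) (M.vH / varRatio M.vH x).toNNReal r := by
    rw [kern_eq_mass_mul hM.vH_pos (Ioo_subset_Icc_self hx), mul_zero, add_zero, add_zero,
      ← mul_assoc, mul_div_cancel_left₀ _ (mul_pos hh hm).ne']
  rw [e] at h
  exact h

theorem IsRegular.tendsto_centredProbH (hM : M.IsRegular) (s : ℝ) :
    Tendsto (fun q => (M.withLow q).centredProbH s) atTop (𝓝 1) := by
  have hp := mul_pos hM.h_pos
    (gaussianPDFReal_pos 0 (M.v₀ + M.vH) s (add_pos hM.v₀_pos hM.vH_pos).ne')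
  have h := (tendsto_const_nhds (x := M.h * gaussianPDFReal 0 (M.v₀ + M.vH) s)).div
    (((tendsto_gaussianPDFReal_atTop 0 s M.v₀).const_mul (1 - M.h)).const_add
    (M.h * gaussianPDFReal 0 (M.v₀ + M.vH) s)) (by simpa using hp.ne')
  rw [mul_zero, add_zero, div_self hp.ne'] at h
  exact h

theorem IsRegular.tendsto_centredWeighted (hM : M.IsRegular) (hx : x ∈ Ioo (0 : ℝ) 1) (r : ℝ) :
    Tendsto (fun q => (M.withLow q).centredWeighted x r) atTop
      (𝓝 ((1 - M.priorWeight M.vH x) * √x * r)) := by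
  have hP := hM.tendsto_centredProbH (√x * r)
  have hi : Tendsto (fun q : ℝ≥0 => (q : ℝ)⁻¹) atTop (𝓝 0) := tendsto_coe_atTop.inv_tendsto_atTop
  have hd : (M.v₀ : ℝ)⁻¹ * x + (1 - x) + 0 * x ≠ 0 := by
    have h1 : 0 ≤ (M.v₀ : ℝ)⁻¹ * x := mul_nonneg (by positivity) hx.1.le
    linarith [hx.2]
  -- Only the existence of this limit matters: it is multiplied by `1 - P(H|s)`, which tends to `0`.
  have hw : Tendsto (fun q => (M.withLow q).priorWeight q x) atTop
      (𝓝 ((M.v₀ : ℝ)⁻¹ * x / ((M.v₀ : ℝ)⁻¹ * x + (1 - x) + 0 * x))) :=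
    tendsto_const_nhds.div ((hi.mul_const x).const_add _) hd
  have h := (((hP.mul_const (M.priorWeight M.vH x)).add
    ((hP.const_sub 1).mul hw)).const_sub 1).mul_const (√x * r)
  rw [sub_self, zero_mul, add_zero, one_mul, ← mul_assoc] at h
  exact h

/-! ### The limit loss and dominated convergence -/

/-- The limit of the loss of the weighted action as the low-quality sources become
uninformative. -/
def limitLoss (M : NormalSampling) (x : ℝ) : ℝ :=
  (1 - (1 - M.priorWeight M.vH x) * √x * (√x / varRatio M.vH x)) ^ 2 * M.v₀ +
    ((1 - M.priorWeight M.vH x) * √x) ^ 2 * (M.vH / varRatio M.vH x)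

/-- Given `δ`, the error `δ - β * r` has mean `(1 - β * c) * δ` and variance `β ^ 2 * V`; the prior
then averages `δ ^ 2` to `p`. -/
theorem lintegral_sq_mul_gaussianPDFReal_mul_gaussianPDFReal (β c : ℝ) {V p : ℝ≥0} (hV : V ≠ 0)
    (hp : p ≠ 0) :
    ∫⁻ z : ℝ × ℝ, ENNReal.ofReal ((z.1 - β * z.2) ^ 2 *
      (gaussianPDFReal (c * z.1) V z.2 * gaussianPDFReal 0 p z.1)) =
      ENNReal.ofReal ((1 - β * c) ^ 2 * p + β ^ 2 * V) := by
  have hm : Measurable fun z : ℝ × ℝ => (z.1 - β * z.2) ^ 2 *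
      (gaussianPDFReal (c * z.1) V z.2 * gaussianPDFReal 0 p z.1) := by
    unfold gaussianPDFReal
    fun_prop
  rw [Measure.volume_eq_prod, lintegral_prod _ hm.ennreal_ofReal.aemeasurable]
  have inner : ∀ δ : ℝ, ∫⁻ r, ENNReal.ofReal ((δ - β * r) ^ 2 *
      (gaussianPDFReal (c * δ) V r * gaussianPDFReal 0 p δ)) =
      ENNReal.ofReal (((0 - (1 - β * c) * δ) ^ 2 + β ^ 2 * V) * gaussianPDFReal 0 p δ) := by
    intro δ
    have h := lintegral_sq_mul_gaussianPDFReal δ β 0 (c * δ) le_rfl hV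
    simp only [add_zero] at h
    simp only [← mul_assoc, ENNReal.ofReal_mul' (gaussianPDFReal_nonneg 0 p δ)]
    rw [lintegral_mul_const' _ _ ENNReal.ofReal_ne_top, h]
    congr 2
    ring
  simp only [inner]
  rw [lintegral_sq_mul_gaussianPDFReal 0 _ _ 0 (by positivity) hp]
  congr 1
  ring

theorem integrable_sq_mul_exp_neg_mul_sq {b : ℝ} (hb : 0 < b) :
    Integrable fun t : ℝ => t ^ 2 * Real.exp (-b * t ^ 2) := by
  simpa using integrable_rpow_mul_exp_neg_mul_sq hb (s := 2) (by norm_num)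

theorem integrable_sq_add_sq_mul_exp {b c : ℝ} (hb : 0 < b) (hc : 0 < c) :
    Integrable fun z : ℝ × ℝ => (z.1 ^ 2 + z.2 ^ 2) *
      (Real.exp (-b * z.1 ^ 2) * Real.exp (-c * z.2 ^ 2)) := by
  have h1 := (integrable_sq_mul_exp_neg_mul_sq hb).mul_prod (integrable_exp_neg_mul_sq hc)
  have h2 := (integrable_exp_neg_mul_sq hb).mul_prod (integrable_sq_mul_exp_neg_mul_sq hc)
  refine (h1.add h2).congr (ae_of_all _ fun z => ?_)
  simp only [Pi.add_apply]
  ring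

/-- A bound uniform in `q` that also decays in `r`, which `signalDensity_le` does not provide. The
low-quality mass is dropped from the denominator; dividing by the high-quality mass alone costs a
factor growing like a Gaussian inverse in `δ`. -/
theorem IsRegular.jointDensity_withLow_le (hM : M.IsRegular) (hx : x ∈ Ioo (0 : ℝ) 1) {q : ℝ≥0}
    (hq : 1 ≤ q) (δ r : ℝ) :
    (M.withLow q).jointDensity x δ r ≤
      ((√(2 * Real.pi * M.vH))⁻¹ + 1) * M.h⁻¹ * √(varRatio M.vH x) * (√(2 * Real.pi * M.v₀))⁻¹ *
        (Real.exp (-((2 * M.v₀ : ℝ)⁻¹ - (1 - x) / (2 * varRatio M.vH x)) * δ ^ 2) *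
          Real.exp (-((1 - x) / 2) * r ^ 2)) := by
  have hx' := Ioo_subset_Icc_self hx
  have hh := hM.h_pos
  have hh' := sub_pos.2 hM.h_lt_one
  have hq0 : 0 < q := zero_lt_one.trans_le hq
  have hv : (0 : ℝ) < M.v₀ := hM.v₀_pos
  have hD := varRatio_pos hM.vH_pos hx'
  have hm := NormalSampling.mass_pos hM.vH_pos hx' δ
  have hmq := NormalSampling.mass_pos hq0 hx' δ
  set E := Real.exp (-((1 - x) * r ^ 2 / 2)) with hE
  have hE0 : 0 < E := Real.exp_pos _
  have k1 : kern M.vH x δ r ≤ E * (√(2 * Real.pi * M.vH))⁻¹ :=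
    mul_le_mul_of_nonneg_left (gaussianPDFReal_le_inv_sqrt _ _ _) hE0.le
  have k2 : kern q x δ r ≤ E * 1 := by
    refine mul_le_mul_of_nonneg_left ((gaussianPDFReal_le_inv_sqrt _ _ _).trans ?_) hE0.le
    refine inv_le_one_of_one_le₀ (Real.one_le_sqrt.2 ?_)
    have hq' : (1 : ℝ) ≤ q := by exact_mod_cast hq
    nlinarith [Real.pi_gt_three]
  have hnum : M.h * kern M.vH x δ r + (1 - M.h) * kern q x δ r ≤
      E * ((√(2 * Real.pi * M.vH))⁻¹ + 1) := by
    have h1 := mul_le_mul hM.h_lt_one.le k1 (kern_nonneg _ _ _ _) zero_le_one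
    have h2 := mul_le_mul (sub_le_self 1 hh.le) k2 (kern_nonneg _ _ _ _) zero_le_one
    linarith
  have hden : M.h * mass M.vH x δ ≤ M.h * mass M.vH x δ + (1 - M.h) * mass q x δ :=
    le_add_of_nonneg_right (mul_pos hh' hmq).le
  calc (M.withLow q).jointDensity x δ r
      = (M.h * kern M.vH x δ r + (1 - M.h) * kern q x δ r) /
        (M.h * mass M.vH x δ + (1 - M.h) * mass q x δ) * gaussianPDFReal 0 M.v₀ δ := rfl
    _ ≤ (E * ((√(2 * Real.pi * M.vH))⁻¹ + 1)) / (M.h * mass M.vH x δ) *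
        gaussianPDFReal 0 M.v₀ δ := by
        refine mul_le_mul_of_nonneg_right ?_ (gaussianPDFReal_nonneg _ _ _)
        exact div_le_div₀ (by positivity) hnum (mul_pos hh hm) hden
    _ = _ := by
        have e1 : (mass M.vH x δ)⁻¹ =
            √(varRatio M.vH x) * Real.exp ((1 - x) * δ ^ 2 / (2 * varRatio M.vH x)) := by
          rw [mass, mul_inv, inv_inv, ← Real.exp_neg, neg_neg]
        have e2 : Real.exp (-((2 * M.v₀ : ℝ)⁻¹ - (1 - x) / (2 * varRatio M.vH x)) * δ ^ 2) =
            Real.exp ((1 - x) * δ ^ 2 / (2 * varRatio M.vH x)) *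
              Real.exp (-(δ - 0) ^ 2 / (2 * M.v₀)) := by
          rw [← Real.exp_add]
          congr 1
          field_simp
          ring
        have e3 : Real.exp (-((1 - x) / 2) * r ^ 2) = E := by
          rw [hE]
          congr 1
          ring
        rw [e2, e3, div_eq_mul_inv, mul_inv, e1, gaussianPDFReal]
        ring

/-- Dominated convergence; `hη` says that the prior decays faster than the inverse of the
high-quality mass grows, which makes the dominating function integrable. -/
theorem IsRegular.tendsto_loss_centredWeighted (hM : M.IsRegular) (hx : x ∈ Ioo (0 : ℝ) 1)
    (hη : (1 - x) / (2 * varRatio M.vH x) < (2 * M.v₀ : ℝ)⁻¹) :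
    Tendsto (fun q => (M.withLow q).loss x ((M.withLow q).centredWeighted x)) atTop
      (𝓝 (ENNReal.ofReal (M.limitLoss x))) := by
  have hx' := Ioo_subset_Icc_self hx
  have hD := varRatio_pos hM.vH_pos hx'
  have hvH : (0 : ℝ) < M.vH := hM.vH_pos
  have hV : 0 < M.vH / varRatio M.vH x := div_pos hvH hD
  have hh := hM.h_pos
  set C := ((√(2 * Real.pi * M.vH))⁻¹ + 1) * M.h⁻¹ * √(varRatio M.vH x) *
    (√(2 * Real.pi * M.v₀))⁻¹ with hC
  have hC0 : 0 ≤ C := by positivity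
  have hlim := lintegral_sq_mul_gaussianPDFReal_mul_gaussianPDFReal
    ((1 - M.priorWeight M.vH x) * √x) (√x / varRatio M.vH x)
    (V := (M.vH / varRatio M.vH x).toNNReal) (by simpa using hV) hM.v₀_pos.ne'
  rw [Real.coe_toNNReal _ hV.le] at hlim
  rw [limitLoss, ← hlim]
  refine tendsto_lintegral_filter_of_dominated_convergence
    (fun z => ENNReal.ofReal (2 * C * ((z.1 ^ 2 + z.2 ^ 2) *
      (Real.exp (-((2 * M.v₀ : ℝ)⁻¹ - (1 - x) / (2 * varRatio M.vH x)) * z.1 ^ 2) *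
        Real.exp (-((1 - x) / 2) * z.2 ^ 2))))) ?_ ?_ ?_ ?_
  · filter_upwards [eventually_ge_atTop 1] with q hq
    have hN := hM.withLow (zero_lt_one.trans_le hq)
    exact (((measurable_fst.sub ((measurable_centredWeighted hN x).comp measurable_snd)).pow_const
      2).mul (measurable_jointDensity _ x)).ennreal_ofReal
  · filter_upwards [eventually_ge_atTop 1] with q hq
    have hN := hM.withLow (zero_lt_one.trans_le hq)
    refine ae_of_all _ fun z => ENNReal.ofReal_le_ofReal ?_
    have h1 := hM.jointDensity_withLow_le hx hq z.1 z.2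
    have h2 : (z.1 - (M.withLow q).centredWeighted x z.2) ^ 2 ≤ 2 * (z.1 ^ 2 + z.2 ^ 2) := by
      have h3 := sq_le_sq.2 (hN.abs_centredWeighted_le hx' z.2)
      nlinarith [sq_nonneg (z.1 + (M.withLow q).centredWeighted x z.2)]
    refine (mul_le_mul h2 h1 (hN.jointDensity_pos hx' _ _).le (by positivity)).trans_eq ?_
    rw [hC]
    ring
  · exact ((integrable_sq_add_sq_mul_exp (sub_pos.2 hη)
      (half_pos (sub_pos.2 hx.2))).const_mul (2 * C)).lintegral_lt_top.ne
  · refine ae_of_all _ fun z => (ENNReal.continuous_ofReal.tendsto _).comp ?_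
    have h := (((hM.tendsto_centredWeighted hx z.2).const_sub z.1).pow 2).mul
      (hM.tendsto_jointDensity hx z.1 z.2)
    rwa [mul_div_right_comm] at h

/-- With high-quality sources only and uniform sampling, the weighted action is the Gaussian
posterior mean, and its loss is the posterior variance. -/
theorem IsRegular.limitLoss_one (hM : M.IsRegular) :
    M.limitLoss 1 = M.v₀ * M.vH / (M.v₀ + M.vH) := by
  have hv : (0 : ℝ) < M.v₀ := hM.v₀_pos
  have hvH : (0 : ℝ) < M.vH := hM.vH_pos
  simp only [limitLoss, priorWeight, varRatio, Real.sqrt_one]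
  simp only [sub_self, zero_mul, zero_add, add_zero, mul_one, div_one]
  field_simp
  ring

theorem IsRegular.continuousOn_limitLoss (hM : M.IsRegular) :
    ContinuousOn M.limitLoss (Icc 0 1) := by
  have h1 := hM.continuousOn_priorWeight M.vH
  have h2 := (continuous_varRatio M.vH).continuousOn (s := Icc (0 : ℝ) 1)
  have h3 : ∀ x ∈ Icc (0 : ℝ) 1, varRatio M.vH x ≠ 0 := fun x hx => (varRatio_pos hM.vH_pos hx).ne'
  have h4 : ContinuousOn (fun x => √x / varRatio M.vH x) (Icc 0 1) :=
    ContinuousOn.div (by fun_prop) h2 h3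
  have h5 : ContinuousOn (fun x => (M.vH : ℝ) / varRatio M.vH x) (Icc 0 1) :=
    continuousOn_const.div h2 h3
  unfold limitLoss
  fun_prop

/-- For some finite sampling variance, the limit loss of the weighted action is less than the limit
of the lower bound for the loss under uniform sampling. -/
theorem IsRegular.exists_limitLoss_lt (hM : M.IsRegular) : ∃ x ∈ Ioo (0 : ℝ) 1,
    (1 - x) / (2 * varRatio M.vH x) < (2 * M.v₀ : ℝ)⁻¹ ∧
      M.limitLoss x < M.h * (M.v₀ * M.vH / (M.v₀ + M.vH)) + (1 - M.h) * M.v₀ := by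
  have hv : (0 : ℝ) < M.v₀ := hM.v₀_pos
  have hvH : (0 : ℝ) < M.vH := hM.vH_pos
  have h1 : (1 : ℝ) ∈ Icc (0 : ℝ) 1 := by simp
  have hlt : M.limitLoss 1 < M.h * (M.v₀ * M.vH / (M.v₀ + M.vH)) + (1 - M.h) * M.v₀ := by
    rw [hM.limitLoss_one]
    have : (M.v₀ * M.vH / (M.v₀ + M.vH) : ℝ) < M.v₀ := by
      rw [div_lt_iff₀ (by positivity)]
      nlinarith
    nlinarith [hM.h_lt_one]
  have hc : ContinuousOn (fun x => (1 - x) / (2 * varRatio M.vH x)) (Icc 0 1) :=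
    ContinuousOn.div (by fun_prop) (continuous_const.mul (continuous_varRatio _)).continuousOn
      fun x hx => (mul_pos two_pos (varRatio_pos hM.vH_pos hx)).ne'
  have hmono : 𝓝[Ioo 0 1] (1 : ℝ) ≤ 𝓝[Icc 0 1] 1 := nhdsWithin_mono _ Ioo_subset_Icc_self
  -- The left side of the integrability condition vanishes at `x = 1`, so the condition holds
  -- nearby.
  have e1 := ((hc 1 h1).mono_left hmono).eventually_lt_const (u := (2 * M.v₀ : ℝ)⁻¹)
    (by simpa using hM.v₀_pos)
  have e2 := ((hM.continuousOn_limitLoss 1 h1).mono_left hmono).eventually_lt_const hlt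
  have : (𝓝[Ioo 0 1] (1 : ℝ)).NeBot :=
    mem_closure_iff_nhdsWithin_neBot.1 (by rw [closure_Ioo zero_ne_one]; exact h1)
  obtain ⟨x, ⟨hx1, hx2⟩, hx⟩ := ((e1.and e2).and self_mem_nhdsWithin).exists
  exact ⟨x, hx, hx1, hx2⟩

/-- If the low-quality sources have a large variance, then some finite sampling variance beats
uniform sampling. -/
theorem IsRegular.exists_eventually_loss_lt (hM : M.IsRegular) : ∃ x ∈ Ioo (0 : ℝ) 1,
    ∀ᶠ q in atTop, (M.withLow q).loss x ((M.withLow q).centredWeighted x) <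
      ENNReal.ofReal (M.h * (M.v₀ * M.vH / (M.v₀ + M.vH)) +
        (1 - M.h) * (M.v₀ * q / (M.v₀ + q))) := by
  obtain ⟨x, hx, hη, hlt⟩ := hM.exists_limitLoss_lt
  have hv : (0 : ℝ) < M.v₀ := hM.v₀_pos
  have hvH : (0 : ℝ) < M.vH := hM.vH_pos
  refine ⟨x, hx, ?_⟩
  have hq : Tendsto (fun q : ℝ≥0 => (M.v₀ * q / (M.v₀ + q) : ℝ)) atTop (𝓝 M.v₀) := by
    have h := (tendsto_const_nhds (x := (M.v₀ : ℝ))).div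
      (((tendsto_coe_atTop.inv_tendsto_atTop).const_mul (M.v₀ : ℝ)).add_const 1) (by simp)
    rw [mul_zero, zero_add, div_one] at h
    refine h.congr' ?_
    filter_upwards [eventually_gt_atTop 0] with q hq
    have hq' : (0 : ℝ) < q := hq
    simp only [Pi.inv_apply, Pi.div_apply]
    field_simp
  have hR := ENNReal.tendsto_ofReal ((hq.const_mul (1 - M.h)).const_add
    (M.h * (M.v₀ * M.vH / (M.v₀ + M.vH))))
  refine (hM.tendsto_loss_centredWeighted hx hη).eventually_lt hR ?_
  rw [ENNReal.ofReal_lt_ofReal_iff']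
  refine ⟨hlt, ?_⟩
  have := hM.h_pos
  have := sub_pos.2 hM.h_lt_one
  positivity

end NormalSampling

end

/-! ### The main theorem -/

theorem mainTheorem7 (h : ℝ) (h_pos : 0 < h) (h_lt_one : h < 1)
    (v₀ vH : ℝ≥0) (hv₀ : 0 < v₀) (hvH : 0 < vH) :
    ∃ κ : ℝ≥0, vH < κ ∧ ∀ (ω₀ : ℝ) (vL : ℝ≥0), κ < vL →
      let M : NormalSampling := { h := h, ω₀ := ω₀, v₀ := v₀, vH := vH, vL := vL }
      ((∃ v, M.IsOptimalVariance M.bayesAction v) ∧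
        ∀ v, M.IsOptimalVariance M.bayesAction v → v < ∞) ∧
      ((∃ v, M.IsOptimalVariance M.weightedAction v) ∧
        ∀ v, M.IsOptimalVariance M.weightedAction v → v < ∞) := by
  -- The values `ω₀ = 0` and `vL = vH` are placeholders: the centred loss does not involve `ω₀`, and
  -- `withLow` overwrites `vL`. Hence `κ` is independent of `ω₀`.
  obtain ⟨x, hx, hev⟩ := NormalSampling.IsRegular.exists_eventually_loss_lt
    (M := { h := h, ω₀ := 0, v₀ := v₀, vH := vH, vL := vH }) ⟨h_pos, h_lt_one, hv₀, hvH, hvH⟩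
  obtain ⟨κ, hκ⟩ := eventually_atTop.1 (hev.and (eventually_gt_atTop vH))
  refine ⟨κ, (hκ κ le_rfl).2, fun ω₀ vL hL => ?_⟩
  intro M
  have hM : M.IsRegular := ⟨h_pos, h_lt_one, hv₀, hvH, hvH.trans (hκ vL hL.le).2⟩
  have hx' := Ioo_subset_Icc_self hx
  set B := ENNReal.ofReal (h * (v₀ * vH / (v₀ + vH)) + (1 - h) * (v₀ * vL / (v₀ + vL))) with hB
  have hw : M.loss x (M.centredWeighted x) < B := (hκ vL hL.le).1
  have hb : M.loss x (M.centredBayes x) < B :=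
    (hM.loss_centredBayes_le hx' (NormalSampling.measurable_centredWeighted hM x)
      (M.measurable_centredBayes x)).trans_lt hw
  have h1 : ∀ {b : ℝ → ℝ}, Measurable b → B ≤ M.loss 1 b := fun hb => hM.le_loss_one hb
  have h0 : ∀ {b : ℝ → ℝ}, Measurable b → B ≤ M.loss 0 b := by
    intro b hb
    refine le_trans ?_ (hM.le_loss_zero hb)
    -- Posterior variances do not exceed the prior variance, so neither does their average `B`.
    have hle : ∀ q : ℝ≥0, (v₀ * q / (v₀ + q) : ℝ) ≤ v₀ := fun q => by
      have hv : (0 : ℝ) < v₀ := hv₀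
      rw [div_le_iff₀ (by positivity)]
      nlinarith
    rw [hB, ← ENNReal.ofReal_coe_nnreal]
    refine ENNReal.ofReal_le_ofReal ?_
    have := mul_le_mul_of_nonneg_left (hle vH) h_pos.le
    have := mul_le_mul_of_nonneg_left (hle vL) (sub_pos.2 h_lt_one).le
    change _ ≤ (v₀ : ℝ)
    linarith
  have mB := M.measurable_centredBayes
  have mW := NormalSampling.measurable_centredWeighted hM
  exact ⟨hM.exists_isOptimalVariance _ M.centredBayes mB hM.continuousOn_centredBayes
      (fun v hv r => hM.bayesAction_eq hv r) hx (hb.trans_le (h0 (mB 0)))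
      (hb.trans_le (h1 (mB 1))),
    hM.exists_isOptimalVariance _ M.centredWeighted mW hM.continuousOn_centredWeighted
      (fun v _ r => hM.weightedAction_eq v r) hx (hw.trans_le (h0 (mW 0)))
      (hw.trans_le (h1 (mW 1)))⟩
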